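/- Conventions. For $y\in\mathbb R$, $p>0$ let $\lfloor y\rceil^{p}=|y|^{p}\operatorname{sign}(y)$, and let $\lfloor y\rceil^{0}$ be the set $\{\operatorname{sign}(y)\}$ if $y\neq 0$ and $[-1,1]$ if $y=0$. Define $c_{i,j}$ for $i,j\in\mathbb N_0$ by $c_{0,0}=1$, $c_{0,j}=c_{i,0}=0$ for $i,j\ne 0$, and $c_{i,j}=\frac{(j-1)c_{i,j-1}+i\,c_{i-1,j-1}}{j}$ for $i,j\ge 1$. For $m\in\mathbb N$ and $M\ge 0$ let $\mathcal F_M^{(m)}$ be the set of $m$ times differentiable $f:[0,\infty)\to\mathbb R$ whose $m$th derivative is Lipschitz continuous and with $|f^{(m+1)}(t)|\le M$ for almost all $t\ge 0$. A sample-based implicit sliding-mode differentiator of order $m$ is a system $z_{k+1}\in F(z_k,z_{k+1},u_k)$, $y_k=g(z_k,z_{k+1},u_k)\in\mathbb R^m$ ($k\ge 1$) with fixed initial value $z_1\in\mathbb R^n$, where for each initial value and each input sequence $(u_k)$ there is exactly one state sequence $(z_k)_{k\ge1}$. It is in discrete-time sliding mode at $k$ if $F(z_k,z_{k+1},u_k)\setminus\{z_{k+1}\}\neq\emptyset$.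 With sampling time $T>0$ it is a proper implicit discretization for signals in $\mathcal F_L^{(m)}$ if there are constants $\mu_1,\dots,\mu_m$ such that for all $M\in[0,L]$, $K\in\mathbb N$ and $f\in\mathcal F_M^{(m)}$: if with input $u_k=f(kT)$ it is in discrete-time sliding mode for all $k\ge K$, then there is an integer $\bar K\ge K$ with $|y_{i,k}-f^{(i)}(kT)|\le\mu_i M T^{m+1-i}$ for all $k\ge\bar K$ and $i=1,\dots,m$. Theorem. Let $m\in\mathbb N$ ($m\ge1$), let $L,T,\lambda_1,\dots,\lambda_{m+1}>0$, and consider the implicit robust exact differentiator (IRED) with arbitrary initial value $z_1\in\mathbb R^{m+1}$, $$z_{i,k+1}=z_{i,k}+T\lambda_iL^{\frac{i}{m+1}}\lfloor u_k-z_{1,k+1}\rceil^{\frac{m-i+1}{m+1}}+Tz_{i+1,k+1}\quad(i=1,\dots,m),$$ $$z_{m+1,k+1}\in z_{m+1,k}+T\lambda_{m+1}L\lfloor u_k-z_{1,k+1}\rceil^{0},\qquad y_{i,k}=\sum_{j=i}^{m}T^{j-i}c_{i,j}z_{j+1,k+1}\quad(i=1,\dots,m).$$ (a) For every input and every $k\ge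 1$, it is in discrete-time sliding mode at $k$ if and only if $z_{1,k+1}=u_k$. (b) Let $M\in[0,L]$ and let the input be $u_k=f(kT)+\eta_k$ with $f\in\mathcal F_M^{(m)}$ and a real sequence $(\eta_k)$. Suppose that there is $K\in\mathbb N$ ($K\ge1$) such that for all $k\ge K$, $\eta_k=0$ and the differentiator is in discrete-time sliding mode at $k$. Then $$|y_{i,k}-f^{(i)}(kT)|\le c_{i,m+1}MT^{m-i+1}\qquad\text{for all } i=1,\dots,m \text{ and all } k\ge K+m+1.$$ If $f(t)=M\frac{t^{m+1}}{(m+1)!}$, then equality holds for all these $i$ and $k$. If $f$ is a polynomial of degree at most $m$, then $y_{i,k}=f^{(i)}(kT)$ for all these $i$ and $k$ (no bias and no chattering). (c) For every initial value and every input sequence the IRED has exactly one state sequence, and it is a proper implicit discretization for signals in $\mathcal F_L^{(m)}$. -/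

import Mathlib

noncomputable section

namespace IRED

open MeasureTheory Set

/-- The signed power `⌊y⌉^p = |y|^p sign y` (used for exponents `p ≠ 0`). -/
def spow (y p : ℝ) : ℝ := |y| ^ p * Real.sign y

/-- The set-valued sign function `⌊y⌉^0`: `{sign y}` for `y ≠ 0`, and `[-1, 1]` for `y = 0`. -/
def setSign (y : ℝ) : Set ℝ := {x | (y ≠ 0 ∧ x = Real.sign y) ∨ (y = 0 ∧ x ∈ Icc (-1 : ℝ) 1)}

/-- The `i`-th derivative of a signal on the time domain `[0, ∞)` (one-sided at `t = 0`). -/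
def sderiv (i : ℕ) (f : ℝ → ℝ) (t : ℝ) : ℝ := iteratedDerivWithin i f (Ici 0) t

/-- Signals on `[0, ∞)` that are `m` times differentiable, with Lipschitz continuous `m`-th
derivative and `|f^(m+1)| ≤ M` almost everywhere on `[0, ∞)`.  A signal is represented by a
function on `ℝ`, of which only the values on `[0, ∞)` matter. -/
def signalClass (m : ℕ) (M : ℝ) : Set (ℝ → ℝ) :=
  {f | (∀ i < m, DifferentiableOn ℝ (sderiv i f) (Ici 0)) ∧
    (∃ C : NNReal, LipschitzOnWith C (sderiv m f) (Ici 0)) ∧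
    ∀ᵐ t ∂(volume.restrict (Ici (0 : ℝ))), |sderiv (m + 1) f t| ≤ M}

/-- The constants `c_{i,j}`:  `c_{0,0} = 1`, `c_{0,j} = c_{i,0} = 0` for `i, j ≠ 0`, and
`c_{i,j} = ((j - 1) c_{i,j-1} + i c_{i-1,j-1}) / j` for `i, j ≥ 1`. -/
def c : ℕ → ℕ → ℝ
  | 0, 0 => 1
  | 0, _ + 1 => 0
  | _ + 1, 0 => 0
  | i + 1, j + 1 => ((j : ℝ) * c (i + 1) j + ((i : ℝ) + 1) * c i j) / ((j : ℝ) + 1)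

/-- A state-space system `z_{k+1} ∈ F (z_k, z_{k+1}, u_k)`, `y_k = g (z_k, z_{k+1}, u_k)` with
`n` states, `m` outputs and a fixed initial value `z_1`.  Coordinates are counted from `0`: the
coordinate `i` of a state or an output is the one with index `i + 1` in one-based counting. -/
structure Differentiator (n m : ℕ) where
  /-- the set-valued right-hand side -/
  F : (Fin n → ℝ) → (Fin n → ℝ) → ℝ → Set (Fin n → ℝ)
  /-- the output map -/
  g : (Fin n → ℝ) → (Fin n → ℝ) → ℝ → Fin m → ℝ
  /-- the initial value `z_1` -/
  init : Fin n → ℝ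

namespace Differentiator

variable {n m : ℕ}

/-- `z` solves the inclusion for all times `k ≥ 1`, with input `u` and `z_1 = a`
(the value `z 0` plays no role). -/
def IsSolutionFrom (D : Differentiator n m) (a : Fin n → ℝ) (u : ℕ → ℝ)
    (z : ℕ → Fin n → ℝ) : Prop :=
  z 1 = a ∧ ∀ k, 1 ≤ k → z (k + 1) ∈ D.F (z k) (z (k + 1)) (u k)

/-- `z` is the state sequence of the differentiator with input `u`. -/
def IsSolution (D : Differentiator n m) (u : ℕ → ℝ) (z : ℕ → Fin n → ℝ) : Prop :=
  D.IsSolutionFrom D.init u z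

/-- The output `y_k` that belongs to the input `u` and the state sequence `z`. -/
def output (D : Differentiator n m) (u : ℕ → ℝ) (z : ℕ → Fin n → ℝ) (k : ℕ) : Fin m → ℝ :=
  D.g (z k) (z (k + 1)) (u k)

/-- For every initial value and every input there is exactly one state sequence. -/
def WellPosed (D : Differentiator n m) : Prop :=
  ∀ (a : Fin n → ℝ) (u : ℕ → ℝ), ∃ z, D.IsSolutionFrom a u z ∧
    ∀ z', D.IsSolutionFrom a u z' → ∀ k, 1 ≤ k → z' k = z k

/-- Discrete-time sliding mode at time index `k`: the set `F (z_k, z_{k+1}, u_k)`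
contains an element other than `z_{k+1}`. -/
def InSlidingMode (D : Differentiator n m) (u : ℕ → ℝ) (z : ℕ → Fin n → ℝ) (k : ℕ) : Prop :=
  (D.F (z k) (z (k + 1)) (u k) \ {z (k + 1)}).Nonempty

/-- A sample-based implicit sliding-mode differentiator with sampling time `T` is a proper implicit
discretization for the signals in `signalClass m L`. -/
def IsProper (D : Differentiator n m) (L T : ℝ) : Prop :=
  D.WellPosed ∧
  ∃ μ : Fin m → ℝ, ∀ M ∈ Icc 0 L, ∀ K : ℕ, 1 ≤ K → ∀ f ∈ signalClass m M,
    ∀ z, D.IsSolution (fun k => f (k * T)) z →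
      (∀ k, K ≤ k → D.InSlidingMode (fun k => f (k * T)) z k) →
      ∃ K' : ℕ, K ≤ K' ∧ ∀ k, K' ≤ k → ∀ i : Fin m,
        |D.output (fun k => f (k * T)) z k i - sderiv (i + 1) f (k * T)| ≤
          μ i * M * T ^ (m - (i : ℕ))

end Differentiator

/-- The implicit robust exact differentiator of order `m` with Lipschitz constant `L`, sampling
time `T`, parameters `lam i = λ_{i+1}` and initial value `z_1 = a`. -/
def ired (m : ℕ) (L T : ℝ) (lam : Fin (m + 1) → ℝ) (a : Fin (m + 1) → ℝ) :
    Differentiator (m + 1) m where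
  F z z' u := {w |
    (∀ i : Fin m, w i.castSucc = z i.castSucc
      + T * lam i.castSucc * L ^ (((i : ℝ) + 1) / ((m : ℝ) + 1))
          * spow (u - z' 0) (((m : ℝ) - (i : ℝ)) / ((m : ℝ) + 1))
      + T * z' i.succ) ∧
    ∃ ξ ∈ setSign (u - z' 0),
      w (Fin.last m) = z (Fin.last m) + T * lam (Fin.last m) * L * ξ}
  g _ z' _ := fun i => ∑ j ∈ Finset.Ici i.succ,
    T ^ ((j : ℕ) - ((i : ℕ) + 1)) * c ((i : ℕ) + 1) (j : ℕ) * z' j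
  init := a

end IRED

end

/-! ### Newton interpolation at equidistant nodes and the constants `c`. -/

noncomputable section

namespace IRED

open Polynomial

/-! In sliding mode `u - z' 0 = 0`, so every correction term vanishes and each of the first `m`
equations says that the next state is a backward difference quotient of the previous one
(`ired_state_eq_fwdDiff`). The states are therefore the Newton coefficients, up to factorials, of
the polynomial interpolating `f` at `kT, (k-1)T, …, (k-m)T`. Up to a power of `T` and a factorial,
`c i j` is the `i`-th derivative of the `j`-th Newton basis polynomial at `kT`; hence the output is
the derivative of the interpolant at its endpoint node (`ired_output_eq`).

The differentiation error comes from a Rolle argument (`newtonInterp_deriv_error`): it is `-c (i +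
1) (m + 1) * T ^ (m - i)` times a difference quotient of the `m`-th derivative of `f`. That quotient
is at most `M` in absolute value on the signal class, is the constant `M` for the extremal monomial,
and is zero for degree at most `m`.

Well-posedness reduces by back substitution to one scalar inclusion, a strictly increasing function
plus a positive multiple of the set-valued sign (`existsUnique_ired_step`). -/

theorem c_nonneg (i j : ℕ) : 0 ≤ c i j := by
  induction j generalizing i with
  | zero => cases i <;> simp [c]
  | succ j ih =>
    cases i with
    | zero => simp [c]
    | succ i =>
      have h1 := ih i
      have h2 := ih (i + 1)
      rw [c]
      positivity

theorem c_pos {i j : ℕ} (hij : i ≤ j) : 0 < c (i + 1) (j + 1) := by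
  induction j generalizing i with
  | zero =>
    obtain rfl : i = 0 := by omega
    simp [c]
  | succ j ih =>
    rw [c]
    rcases hij.lt_or_eq with h | rfl
    · have h1 := ih (i := i) (by omega)
      have h2 := c_nonneg i (j + 1)
      positivity
    · have h1 := c_nonneg (j + 1 + 1) (j + 1)
      have h2 := ih le_rfl
      positivity

theorem c_zero_right (i : ℕ) : c (i + 1) 0 = 0 := by simp [c]

theorem c_eq_zero_of_lt {i j : ℕ} (hij : j < i) : c i j = 0 := by
  induction j generalizing i with
  | zero =>
    obtain ⟨i, rfl⟩ : ∃ l, i = l + 1 := ⟨i - 1, by omega⟩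
    exact c_zero_right i
  | succ j ih =>
    obtain ⟨i, rfl⟩ : ∃ l, i = l + 1 := ⟨i - 1, by omega⟩
    rw [c, ih (by omega), ih (by omega)]
    simp

/-- Leibniz rule in which only two terms survive, since the second factor is affine. It drives the
recursion for `c`. -/
theorem iterate_derivative_mul_X_add_C (p : ℝ[X]) (a : ℝ) (i : ℕ) :
    derivative^[i + 1] (p * (X + C a))
      = derivative^[i + 1] p * (X + C a) + C ((i : ℝ) + 1) * derivative^[i] p := by
  induction i with
  | zero => simp
  | succ i ih =>
    rw [Function.iterate_succ_apply', ih, derivative_add, derivative_mul, derivative_C_mul,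
      ← Function.iterate_succ_apply' derivative (i + 1), ← Function.iterate_succ_apply' derivative i]
    simp
    ring

/-- The Newton basis polynomial `∏_{l < j} (X - (x + l h))`. -/
def newtonBasis (x h : ℝ) : ℕ → ℝ[X]
  | 0 => 1
  | j + 1 => newtonBasis x h j * (X + C (-(x + j * h)))

theorem newtonBasis_monic (x h : ℝ) (j : ℕ) : (newtonBasis x h j).Monic := by
  induction j with
  | zero => exact monic_one
  | succ j ih => exact ih.mul (monic_X_add_C _)

theorem natDegree_newtonBasis (x h : ℝ) (j : ℕ) : (newtonBasis x h j).natDegree = j := by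
  induction j with
  | zero => simp [newtonBasis]
  | succ j ih =>
    rw [newtonBasis, (newtonBasis_monic x h j).natDegree_mul (monic_X_add_C _), ih,
      natDegree_X_add_C]

theorem eval_newtonBasis (x h : ℝ) (n j : ℕ) :
    (newtonBasis x h j).eval (x + n * h) = n.descFactorial j * h ^ j := by
  induction j with
  | zero => simp [newtonBasis]
  | succ j ih =>
    rw [newtonBasis, eval_mul, ih, Nat.descFactorial_succ]
    rcases le_or_gt j n with h | h
    · push_cast [h]
      simp
      ring
    · simp [Nat.descFactorial_of_lt h]

/-- The last factor of the basis polynomial takes the value `-j h` at `x`, so the Leibniz rule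
reproduces the defining recursion of `c`. Keeping `(-h) ^ i` on the left avoids negative powers. -/
theorem eval_iterate_derivative_newtonBasis (x h : ℝ) (i j : ℕ) :
    (-h) ^ i * (derivative^[i] (newtonBasis x h j)).eval x
      = (-h) ^ j * j.factorial * c i j := by
  induction j generalizing i with
  | zero =>
    cases i with
    | zero => simp [newtonBasis, c]
    | succ i => simp [newtonBasis, c]
  | succ j ih =>
    cases i with
    | zero =>
      have := eval_newtonBasis x h 0 (j + 1)
      simp at this
      simp [this, c]
    | succ i =>
      have h1 := ih i
      have h2 := ih (i + 1)
      rw [newtonBasis, iterate_derivative_mul_X_add_C, c, Nat.factorial_succ]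
      simp only [eval_add, eval_mul, eval_X, eval_C]
      push_cast
      field_simp
      linear_combination (j : ℝ) * (-h) * h2 + ((i : ℝ) + 1) * (-h) * h1

/-- The Newton interpolation polynomial of `f` with the nodes `x, x + h, …, x + m h`. -/
def newtonInterp (f : ℝ → ℝ) (x h : ℝ) (m : ℕ) : ℝ[X] :=
  ∑ j ∈ Finset.range (m + 1), C ((fwdDiff h)^[j] f x / (j.factorial * h ^ j)) * newtonBasis x h j

theorem natDegree_newtonInterp_le (f : ℝ → ℝ) (x h : ℝ) (m : ℕ) :
    (newtonInterp f x h m).natDegree ≤ m := by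
  refine natDegree_sum_le_of_forall_le _ _ fun j hj => (natDegree_C_mul_le _ _).trans ?_
  rw [natDegree_newtonBasis]
  have := Finset.mem_range.1 hj
  omega

/-- This is the Gregory–Newton formula: the basis polynomials with index above `n` vanish at the
node `x + n h`. -/
theorem eval_newtonInterp (f : ℝ → ℝ) (x : ℝ) {h : ℝ} (hh : h ≠ 0) {m n : ℕ} (hn : n ≤ m) :
    (newtonInterp f x h m).eval (x + n * h) = f (x + n * h) := by
  have key := shift_eq_sum_fwdDiff_iter h f n x
  rw [nsmul_eq_mul] at key
  rw [key, newtonInterp, eval_finsetSum, ← Finset.sum_subset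
    (Finset.range_subset_range.2 (Nat.add_le_add_right hn 1))]
  · refine Finset.sum_congr rfl fun j _ => ?_
    rw [eval_mul, eval_C, eval_newtonBasis, Nat.descFactorial_eq_factorial_mul_choose, nsmul_eq_mul]
    have := j.factorial_ne_zero
    push_cast
    field_simp
  · intro j _ hj
    have : n < j := by simpa using hj
    rw [eval_mul, eval_newtonBasis, Nat.descFactorial_of_lt this]
    simp

theorem eval_iterate_derivative_newtonInterp (f : ℝ → ℝ) (x : ℝ) {h : ℝ} (hh : h ≠ 0) (m i : ℕ) :
    (-h) ^ i * (derivative^[i] (newtonInterp f x h m)).eval x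
      = ∑ j ∈ Finset.range (m + 1), (-h) ^ j * c i j * ((fwdDiff h)^[j] f x / h ^ j) := by
  rw [newtonInterp, iterate_derivative_sum, eval_finsetSum, Finset.mul_sum]
  refine Finset.sum_congr rfl fun j _ => ?_
  rw [iterate_derivative_C_mul, eval_mul, eval_C, mul_left_comm,
    eval_iterate_derivative_newtonBasis]
  have := j.factorial_ne_zero
  field_simp

/-- The `m`-th derivative of `q` is affine, with slope fixed by the top coefficient. -/
theorem eval_iterate_derivative_sub {q : ℝ[X]} {m : ℕ} (hq : q.natDegree ≤ m + 1) (a b : ℝ) :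
    (derivative^[m] q).eval b - (derivative^[m] q).eval a
      = (m + 1).factorial * q.coeff (m + 1) * (b - a) := by
  have hd : (derivative^[m] q).natDegree ≤ 1 :=
    (natDegree_iterate_derivative q m).trans (by omega)
  have hc := coeff_iterate_derivative q (k := m) 1
  rw [eq_X_add_C_of_natDegree_le_one hd, hc, Nat.add_comm 1 m]
  have : (m + 1).descFactorial m = (m + 1).factorial := by
    rw [Nat.descFactorial_eq_div (by omega)]; simp
  rw [this]
  simp
  ring

/-! ### Rolle's theorem and the endpoint differentiation error. -/

/-- Rolle's theorem between successive zeros on `[0, ∞)`. -/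
theorem exists_zeros_of_rolle_step {r : ℕ} {G G' : ℝ → ℝ} {x : ℕ → ℝ}
    (hG : ∀ t, 0 ≤ t → HasDerivWithinAt G (G' t) (Set.Ici 0) t) (hx0 : 0 ≤ x 0)
    (hx : ∀ j < r + 1, x j < x (j + 1)) (hz : ∀ j ≤ r + 1, G (x j) = 0) :
    ∃ y : ℕ → ℝ, 0 ≤ y 0 ∧ (∀ j < r, y j < y (j + 1)) ∧ (∀ j ≤ r, G' (y j) = 0) ∧
      y r < x (r + 1) := by
  have hpos : ∀ j ≤ r + 1, 0 ≤ x j := by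
    intro j
    induction j with
    | zero => exact fun _ => hx0
    | succ j ih => exact fun hj => (ih (by omega)).trans (hx j (by omega)).le
  have key : ∀ j, ∃ y, j ≤ r → x j < y ∧ y < x (j + 1) ∧ G' y = 0 := by
    intro j
    by_cases hj : j ≤ r
    · obtain ⟨y, hy, hy'⟩ := exists_hasDerivAt_eq_zero (f := G) (f' := G')
        (hx j (by omega))
        (fun t ht => ((hG t ((hpos j (by omega)).trans ht.1)).continuousWithinAt).mono
          fun s hs => (hpos j (by omega)).trans hs.1)
        ((hz j (by omega)).trans (hz (j + 1) (by omega)).symm)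
        (fun t ht => (hG t ((hpos j (by omega)).trans ht.1.le)).hasDerivAt
          (Ici_mem_nhds ((hpos j (by omega)).trans_lt ht.1)))
      exact ⟨y, fun _ => ⟨hy.1, hy.2, hy'⟩⟩
    · exact ⟨0, fun h => absurd h hj⟩
  choose y hy using key
  refine ⟨y, hx0.trans (hy 0 (by omega)).1.le, fun j hj => ?_, fun j hj => (hy j hj).2.2,
    (hy r le_rfl).2.1⟩
  exact (hy j (by omega)).2.1.trans (hy (j + 1) (by omega)).1

/-- Iterated Rolle theorem on `[0, ∞)`. -/
theorem exists_zeros_of_rolle {r : ℕ} (n : ℕ) {G : ℕ → ℝ → ℝ} {x : ℕ → ℝ}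
    (hG : ∀ j < n, ∀ t, 0 ≤ t → HasDerivWithinAt (G j) (G (j + 1) t) (Set.Ici 0) t)
    (hx0 : 0 ≤ x 0) (hx : ∀ j < r + n, x j < x (j + 1)) (hz : ∀ j ≤ r + n, G 0 (x j) = 0) :
    ∃ y : ℕ → ℝ, 0 ≤ y 0 ∧ (∀ j < r, y j < y (j + 1)) ∧ (∀ j ≤ r, G n (y j) = 0) ∧
      y r ≤ x (r + n) := by
  induction n generalizing G x with
  | zero => exact ⟨x, hx0, hx, hz, le_rfl⟩
  | succ n ih =>
    obtain ⟨y, hy0, hy, hyz, hyr⟩ := exists_zeros_of_rolle_step (r := r + n) (hG 0 (by omega))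
      hx0 hx hz
    obtain ⟨w, hw0, hw, hwz, hwr⟩ := ih (G := fun j => G (j + 1)) (x := y)
      (fun j hj => hG (j + 1) (by omega)) hy0 hy hyz
    exact ⟨w, hw0, hw, hwz, hwr.trans hyr.le⟩

theorem sderiv_hasDerivWithinAt {f : ℝ → ℝ} {i : ℕ}
    (hf : DifferentiableOn ℝ (sderiv i f) (Set.Ici 0)) {t : ℝ} (ht : 0 ≤ t) :
    HasDerivWithinAt (sderiv i f) (sderiv (i + 1) f t) (Set.Ici 0) t := by
  have := (hf t ht).hasDerivWithinAt
  unfold sderiv at *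
  rwa [iteratedDerivWithin_succ]

theorem sderiv_eq_of_eq_polynomial {f : ℝ → ℝ} {p : ℝ[X]} (hf : ∀ t, 0 ≤ t → f t = p.eval t)
    (i : ℕ) {t : ℝ} (ht : 0 ≤ t) : sderiv i f t = (derivative^[i] p).eval t := by
  induction i generalizing t with
  | zero => simpa [sderiv] using hf t ht
  | succ i ih =>
    have h1 : sderiv (i + 1) f t = derivWithin (sderiv i f) (Set.Ici 0) t := by
      unfold sderiv
      rw [iteratedDerivWithin_succ]
    have h2 : Set.EqOn (sderiv i f) (fun s => (derivative^[i] p).eval s) (Set.Ici 0) :=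
      fun s hs => ih hs
    rw [h1, derivWithin_congr h2 (ih ht), Function.iterate_succ_apply']
    exact ((derivative^[i] p).hasDerivAt t).hasDerivWithinAt.derivWithin
      (uniqueDiffOn_Ici 0 t ht)

theorem differentiableOn_sderiv_of_eq_polynomial {f : ℝ → ℝ} {p : ℝ[X]}
    (hf : ∀ t, 0 ≤ t → f t = p.eval t) (i : ℕ) :
    DifferentiableOn ℝ (sderiv i f) (Set.Ici 0) :=
  (derivative^[i] p).differentiable.differentiableOn.congr
    fun _ ht => sderiv_eq_of_eq_polynomial hf i ht

/-- The endpoint error of differentiating the interpolation polynomial with equidistant nodes. -/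
theorem newtonInterp_deriv_error {f : ℝ → ℝ} {m i : ℕ} {T x : ℝ} (hT : 0 < T) (hx : m * T ≤ x)
    (hf : ∀ j < m, DifferentiableOn ℝ (sderiv j f) (Set.Ici 0)) (him : i < m) :
    ∃ a b, 0 ≤ a ∧ a < b ∧
      (derivative^[i + 1] (newtonInterp f x (-T) m)).eval x - sderiv (i + 1) f x
        = -(c (i + 1) (m + 1) * T ^ (m - i) * ((sderiv m f b - sderiv m f a) / (b - a))) := by
  set p := newtonInterp f x (-T) m with hp
  set N := newtonBasis x (-T) (m + 1) with hN
  have hc : 0 < c (i + 1) (m + 1) := c_pos him.le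
  have hd : (derivative^[i + 1] N).eval x = T ^ (m - i) * (m + 1).factorial * c (i + 1) (m + 1) := by
    have := eval_iterate_derivative_newtonBasis x (-T) (i + 1) (m + 1)
    have hp : T ^ (m + 1) = T ^ (i + 1) * T ^ (m - i) := by
      rw [← pow_add]; congr 1; omega
    rw [neg_neg, hp] at this
    have hT' : T ^ (i + 1) ≠ 0 := by positivity
    apply mul_left_cancel₀ hT'
    rw [this]; ring
  set d := (derivative^[i + 1] N).eval x
  have hd0 : 0 < d := by rw [hd]; positivity
  -- `A` is chosen so that adding `A * N`, which vanishes at all nodes, makes the derivative of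
  -- order `i + 1` agree with that of `f` at `x`.
  set A := (sderiv (i + 1) f x - (derivative^[i + 1] p).eval x) / d with hA
  set q := p + C A * N with hq
  have hqdeg : q.natDegree ≤ m + 1 := by
    refine (natDegree_add_le _ _).trans (max_le ?_ ?_)
    · exact (natDegree_newtonInterp_le _ _ _ _).trans (by omega)
    · exact (natDegree_C_mul_le _ _).trans (natDegree_newtonBasis _ _ _).le
  have hqcoeff : q.coeff (m + 1) = A := by
    have h1 : p.coeff (m + 1) = 0 := coeff_eq_zero_of_natDegree_lt
      (Nat.lt_succ_of_le (natDegree_newtonInterp_le _ _ _ _))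
    have h2 : N.coeff (m + 1) = 1 := by
      have := (newtonBasis_monic x (-T) (m + 1)).coeff_natDegree
      rwa [natDegree_newtonBasis] at this
    rw [hq, coeff_add, coeff_C_mul, h1, h2]; ring
  let G : ℕ → ℝ → ℝ := fun j t => sderiv j f t - (derivative^[j] q).eval t
  have hG : ∀ j < m, ∀ t, 0 ≤ t → HasDerivWithinAt (G j) (G (j + 1) t) (Set.Ici 0) t := by
    intro j hj t ht
    refine (sderiv_hasDerivWithinAt (hf j hj) ht).sub ?_
    rw [Function.iterate_succ_apply']
    exact ((derivative^[j] q).hasDerivAt t).hasDerivWithinAt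
  have hGi : G (i + 1) x = 0 := by
    simp only [G, hq]
    rw [iterate_map_add, iterate_derivative_C_mul, eval_add, eval_mul, eval_C]
    change _ - (_ + A * d) = 0
    rw [hA]; field_simp; ring
  have hnode : ∀ n ≤ m, G 0 (x + n * (-T)) = 0 := by
    intro n hn
    have h1 := eval_newtonInterp f x (neg_ne_zero.2 hT.ne') hn
    have h2 := eval_newtonBasis x (-T) n (m + 1)
    rw [Nat.descFactorial_of_lt (by omega), Nat.cast_zero, zero_mul] at h2
    simp only [G, hq, Function.iterate_zero, id, eval_add, eval_mul]
    rw [hp, hN, h1, h2]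
    simp [sderiv]
  obtain ⟨l, rfl⟩ : ∃ l, m = l + 1 + i := ⟨m - 1 - i, by omega⟩
  -- The nodes are listed in increasing order, ending at `x`. The `m + 1` zeros of `G 0` leave `l +
  -- 2` zeros of `G i`.
  obtain ⟨y, hy0, hy, hyz, hyr⟩ := exists_zeros_of_rolle (r := l + 1) i (G := G)
    (x := fun j => x + (((l + 1 + i : ℕ) : ℝ) - j) * (-T))
    (fun j hj => hG j (by omega)) (by push_cast at hx ⊢; linarith)
    (fun j hj => by push_cast; linarith)
    (fun j hj => by
      have := hnode (l + 1 + i - j) (by omega)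
      rwa [Nat.cast_sub hj] at this)
  -- One separate Rolle step gives zeros of `G (i + 1)` strictly left of `x`, so the zero at `x` is
  -- an additional one. The resulting `l + 2` zeros leave two zeros of `G m` after `l` more steps.
  obtain ⟨w, hw0, hw, hwz, hwr⟩ := exists_zeros_of_rolle_step (r := l) (hG i (by omega)) hy0 hy hyz
  have hwx : w l < x := hwr.trans_le (by simpa using hyr)
  obtain ⟨v, hv0, hv, hvz, -⟩ := exists_zeros_of_rolle (r := 1) l (G := fun j => G (i + 1 + j))
    (x := fun j => if j ≤ l then w j else x)
    (fun j hj => hG (i + 1 + j) (by omega)) (by simpa using hw0)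
    (fun j hj => by
      rcases (show j ≤ l by omega).lt_or_eq with h | rfl
      · simpa [h.le, Nat.succ_le_of_lt h] using hw j h
      · simpa using hwx)
    (fun j hj => by
      by_cases h : j ≤ l
      · simpa [h] using hwz j h
      · simpa [h] using hGi)
  refine ⟨v 0, v 1, hv0, hv 0 one_pos, ?_⟩
  have e0 := hvz 0 (by omega)
  have e1 := hvz 1 le_rfl
  have hidx : i + 1 + l = l + 1 + i := by omega
  simp only [G, hidx] at e0 e1
  have hsub := eval_iterate_derivative_sub hqdeg (v 0) (v 1)
  rw [hqcoeff] at hsub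
  have hba : v 1 - v 0 ≠ 0 := (sub_pos.2 (hv 0 one_pos)).ne'
  have hfac : ((l + 1 + i + 1).factorial : ℝ) ≠ 0 := by exact_mod_cast Nat.factorial_ne_zero _
  have hslope : (sderiv (l + 1 + i) f (v 1) - sderiv (l + 1 + i) f (v 0)) / (v 1 - v 0)
      = (l + 1 + i + 1).factorial * A := by
    rw [div_eq_iff hba]; linarith
  have hAd : A * d = sderiv (i + 1) f x - (derivative^[i + 1] p).eval x := by
    rw [hA]; field_simp
  rw [hslope]
  rw [hd] at hAd
  linarith

/-- A Lipschitz function is absolutely continuous, hence the integral of its derivative, so the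
almost-everywhere bound suffices. -/
theorem abs_sub_le_of_signalClass {m : ℕ} {M : ℝ} {f : ℝ → ℝ} (hf : f ∈ signalClass m M)
    {a b : ℝ} (ha : 0 ≤ a) (hab : a ≤ b) :
    |sderiv m f b - sderiv m f a| ≤ M * (b - a) := by
  obtain ⟨-, ⟨K, hK⟩, hae⟩ := hf
  have hsub : Set.uIcc a b ⊆ Set.Ici 0 := by
    rw [Set.uIcc_of_le hab]
    exact fun t ht => ha.trans ht.1
  have hac : AbsolutelyContinuousOnInterval (sderiv m f) a b :=
    (hK.mono hsub).absolutelyContinuousOnInterval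
  rw [← hac.integral_deriv_eq_sub, ← Real.norm_eq_abs, ← abs_of_nonneg (sub_nonneg.2 hab)]
  refine intervalIntegral.norm_integral_le_of_norm_le_const_ae ?_
  rw [MeasureTheory.ae_restrict_iff' measurableSet_Ici] at hae
  filter_upwards [hae] with t ht hmem
  rw [Set.uIoc_of_le hab] at hmem
  have h0 : 0 < t := ha.trans_lt hmem.1
  have h1 := ht h0.le
  simp only [sderiv, iteratedDerivWithin_succ] at h1 ⊢
  rwa [derivWithin_of_mem_nhds (Ici_mem_nhds h0)] at h1

end IRED
end

/-! ### Signed powers and the scalar inclusion. -/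

noncomputable section

namespace IRED

theorem spow_zero {p : ℝ} : spow 0 p = 0 := by simp [spow]

theorem spow_of_nonneg {y p : ℝ} (hy : 0 ≤ y) (hp : p ≠ 0) : spow y p = y ^ p := by
  rcases hy.eq_or_lt with rfl | h
  · simp [spow, Real.zero_rpow hp]
  · simp [spow, abs_of_pos h, Real.sign_of_pos h]

theorem spow_neg (y p : ℝ) : spow (-y) p = -spow y p := by
  simp [spow, Real.sign_neg]

theorem spow_mono {p : ℝ} (hp : 0 < p) : Monotone fun y => spow y p := by
  have key : ∀ a b : ℝ, 0 ≤ a → a ≤ b → spow a p ≤ spow b p := by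
    intro a b ha hab
    rw [spow_of_nonneg ha hp.ne', spow_of_nonneg (ha.trans hab) hp.ne']
    exact Real.rpow_le_rpow ha hab hp.le
  have nonneg : ∀ a : ℝ, 0 ≤ a → 0 ≤ spow a p := fun a ha => by
    simpa [spow_zero] using key 0 a le_rfl ha
  intro a b hab
  change spow a p ≤ spow b p
  rcases le_total 0 a with ha | ha
  · exact key a b ha hab
  rcases le_total 0 b with hb | hb
  · have h1 := nonneg (-a) (by linarith)
    rw [spow_neg] at h1
    linarith [nonneg b hb]
  · have := key (-b) (-a) (by linarith) (by linarith)
    rw [spow_neg, spow_neg] at this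
    linarith

theorem setSign_monotone {a b x y : ℝ} (hab : a < b) (hx : x ∈ setSign a) (hy : y ∈ setSign b) :
    x ≤ y := by
  have le_one : ∀ {e ξ : ℝ}, ξ ∈ setSign e → ξ ≤ 1 ∧ -1 ≤ ξ := by
    rintro e ξ (⟨h, rfl⟩ | ⟨-, h⟩)
    · rcases Real.sign_apply_eq e with h | h | h <;> rw [h] <;> norm_num
    · exact ⟨h.2, h.1⟩
  by_cases ha : a < 0
  · obtain ⟨-, rfl⟩ | ⟨h, -⟩ := hx
    · rw [Real.sign_of_neg ha]; exact (le_one hy).2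
    · exact absurd h ha.ne
  · have hb : 0 < b := (not_lt.1 ha).trans_lt hab
    obtain ⟨-, rfl⟩ | ⟨h, -⟩ := hy
    · rw [Real.sign_of_pos hb]; exact (le_one hx).1
    · exact absurd h hb.ne'

/-- The scalar inclusion that one step of an implicit sliding-mode system reduces to. -/
theorem exists_add_mul_setSign_eq {φ : ℝ → ℝ} (hφ : ContinuousOn φ (Set.Ici 0))
    (hle : ∀ e, 0 ≤ e → e ≤ φ e) (hodd : ∀ e, φ (-e) = -φ e) {b : ℝ} (hb : 0 < b) (w : ℝ) :
    ∃ e, ∃ ξ ∈ setSign e, φ e + b * ξ = w := by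
  have h0 : φ 0 = 0 := by have := hodd 0; rw [neg_zero] at this; linarith
  have pos : ∀ v, b < v → ∃ e, 0 < e ∧ φ e + b = v := by
    intro v hv
    have hv' : 0 ≤ v - b := by linarith
    -- The growth condition at `v - b` provides the upper end for the intermediate value theorem.
    obtain ⟨e, he, hev⟩ := intermediate_value_Icc hv' (hφ.mono fun t ht => ht.1)
      (show v - b ∈ Set.Icc (φ 0) (φ (v - b)) from ⟨by rw [h0]; exact hv', hle _ hv'⟩)
    refine ⟨e, he.1.lt_of_ne ?_, by linarith⟩
    rintro rfl
    linarith
  rcases lt_or_ge b w with h | h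
  · obtain ⟨e, he, hev⟩ := pos w h
    exact ⟨e, 1, Or.inl ⟨he.ne', (Real.sign_of_pos he).symm⟩, by linarith⟩
  rcases lt_or_ge b (-w) with h' | h'
  · obtain ⟨e, he, hev⟩ := pos (-w) h'
    refine ⟨-e, -1, Or.inl ⟨(neg_neg_of_pos he).ne, (Real.sign_of_neg (neg_neg_of_pos he)).symm⟩, ?_⟩
    rw [hodd]
    linarith
  -- For `|w| ≤ b` the set-valued part alone absorbs `w`; this is the sliding case `e = 0`.
  · refine ⟨0, w / b, Or.inr ⟨rfl, ?_, ?_⟩, ?_⟩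
    · rw [le_div_iff₀ hb]; linarith
    · rw [div_le_iff₀ hb]; linarith
    · rw [h0]; field_simp; ring

/-- A strictly increasing function plus a monotone set-valued map has disjoint values at distinct
points. -/
theorem eq_of_add_mul_setSign_eq {φ : ℝ → ℝ} (hφ : StrictMono φ) {b : ℝ} (hb : 0 < b)
    {e e' ξ ξ' : ℝ} (hξ : ξ ∈ setSign e) (hξ' : ξ' ∈ setSign e')
    (h : φ e + b * ξ = φ e' + b * ξ') : e = e' ∧ ξ = ξ' := by
  rcases lt_trichotomy e e' with he | rfl | he
  · have h1 := hφ he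
    have h2 := mul_le_mul_of_nonneg_left (setSign_monotone he hξ hξ') hb.le
    linarith
  · exact ⟨rfl, mul_left_cancel₀ hb.ne' (add_left_cancel h)⟩
  · have h1 := hφ he
    have h2 := mul_le_mul_of_nonneg_left (setSign_monotone he hξ' hξ) hb.le
    linarith

/-! ### Back substitution, well-posedness and the sliding-mode criterion. -/

theorem backSubst_apply_zero {m : ℕ} {T : ℝ} {v : Fin (m + 1) → ℝ} {B : Fin m → ℝ}
    (hv : ∀ i : Fin m, v i.castSucc = B i + T * v i.succ) :
    v 0 = ∑ i : Fin m, T ^ (i : ℕ) * B i + T ^ m * v (Fin.last m) := by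
  induction m with
  | zero => simp
  | succ m ih =>
    have h := ih (v := fun i => v i.succ) (B := fun i => B i.succ) fun i => by
      simpa using hv i.succ
    have h0 := hv 0
    simp only [Fin.castSucc_zero, Fin.succ_zero_eq_one, Fin.succ_last] at h h0
    rw [h0, Fin.sum_univ_succ, h, mul_add, Finset.mul_sum]
    simp only [Fin.val_zero, pow_zero, one_mul, Fin.val_succ, pow_succ']
    rw [add_assoc]
    congr 2
    · exact Finset.sum_congr rfl fun i _ => by ring
    · ring

theorem backSubst_unique {m : ℕ} {T : ℝ} {v w : Fin (m + 1) → ℝ} {B : Fin m → ℝ}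
    (hv : ∀ i : Fin m, v i.castSucc = B i + T * v i.succ)
    (hw : ∀ i : Fin m, w i.castSucc = B i + T * w i.succ)
    (hlast : v (Fin.last m) = w (Fin.last m)) : v = w := by
  funext i
  induction i using Fin.reverseInduction with
  | last => exact hlast
  | cast i ih => rw [hv, hw, ih]

theorem backSubst_exists {m : ℕ} (T : ℝ) (B : Fin m → ℝ) (l : ℝ) :
    ∃ v : Fin (m + 1) → ℝ, (∀ i : Fin m, v i.castSucc = B i + T * v i.succ) ∧
      v (Fin.last m) = l :=
  ⟨fun i => Fin.reverseInduction (motive := fun _ => ℝ) l (fun i r => B i + T * r) i,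
    fun i => by simp, by simp⟩

section

variable {m : ℕ} {L T : ℝ} {lam : Fin (m + 1) → ℝ}

/-- The correction term `T λ_i L^{i/(m+1)} ⌊e⌉^{(m-i+1)/(m+1)}` of the `i`-th equation. -/
def correction (L T : ℝ) (lam : Fin (m + 1) → ℝ) (e : ℝ) (i : Fin m) : ℝ :=
  T * lam i.castSucc * L ^ (((i : ℝ) + 1) / ((m : ℝ) + 1))
    * spow e (((m : ℝ) - (i : ℝ)) / ((m : ℝ) + 1))

theorem exponent_pos (i : Fin m) : 0 < ((m : ℝ) - (i : ℝ)) / ((m : ℝ) + 1) := by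
  have : (i : ℝ) < m := by exact_mod_cast i.2
  exact div_pos (by linarith) (by positivity)

theorem correction_zero (i : Fin m) : correction L T lam 0 i = 0 := by
  simp [correction, spow_zero]

/-- The continuous part `e + ∑ i, T^i * correction` of the scalar step equation. -/
def stepFun (L T : ℝ) (lam : Fin (m + 1) → ℝ) (e : ℝ) : ℝ :=
  e + ∑ i : Fin m, T ^ (i : ℕ) * correction L T lam e i

theorem correction_mono (hL : 0 < L) (hT : 0 < T) (hlam : ∀ i, 0 < lam i) (i : Fin m) :
    Monotone fun e => correction L T lam e i := fun _ _ h =>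
  mul_le_mul_of_nonneg_left (spow_mono (exponent_pos i) h)
    (mul_nonneg (mul_nonneg hT.le (hlam _).le) (Real.rpow_nonneg hL.le _))

theorem stepFun_strictMono (hL : 0 < L) (hT : 0 < T) (hlam : ∀ i, 0 < lam i) :
    StrictMono (stepFun L T lam) := fun _ _ h =>
  add_lt_add_of_lt_of_le h <| Finset.sum_le_sum fun i _ =>
    mul_le_mul_of_nonneg_left (correction_mono hL hT hlam i h.le) (pow_nonneg hT.le _)

theorem stepFun_neg (e : ℝ) : stepFun L T lam (-e) = -stepFun L T lam e := by
  simp only [stepFun, correction, spow_neg, mul_neg, Finset.sum_neg_distrib]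
  ring

theorem continuousOn_stepFun : ContinuousOn (stepFun L T lam) (Set.Ici 0) := by
  refine continuousOn_id.add (continuousOn_finsetSum _ fun i _ => continuousOn_const.mul
    (continuousOn_const.mul ?_))
  exact (continuousOn_id.rpow_const fun _ _ => Or.inr (exponent_pos i).le).congr
    fun e he => spow_of_nonneg he (exponent_pos i).ne'

theorem le_stepFun (hL : 0 < L) (hT : 0 < T) (hlam : ∀ i, 0 < lam i) {e : ℝ} (he : 0 ≤ e) :
    e ≤ stepFun L T lam e := by
  refine le_add_of_nonneg_right (Finset.sum_nonneg fun i _ => mul_nonneg (pow_nonneg hT.le _) ?_)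
  simpa [correction_zero] using correction_mono hL hT hlam i he

variable {a : Fin (m + 1) → ℝ}

theorem mem_ired_F {z z' w : Fin (m + 1) → ℝ} {u : ℝ} :
    w ∈ (ired m L T lam a).F z z' u ↔
      (∀ i : Fin m, w i.castSucc = z i.castSucc + correction L T lam (u - z' 0) i
        + T * z' i.succ) ∧
      ∃ ξ ∈ setSign (u - z' 0),
        w (Fin.last m) = z (Fin.last m) + T * lam (Fin.last m) * L * ξ :=
  Iff.rfl

theorem existsUnique_ired_step (hL : 0 < L) (hT : 0 < T) (hlam : ∀ i, 0 < lam i)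
    (z : Fin (m + 1) → ℝ) (u : ℝ) : ∃! z', z' ∈ (ired m L T lam a).F z z' u := by
  set b := T ^ m * (T * lam (Fin.last m) * L) with hb
  have hb0 : 0 < b := by have := hlam (Fin.last m); positivity
  set w := u - (∑ i : Fin m, T ^ (i : ℕ) * z i.castSucc + T ^ m * z (Fin.last m)) with hw
  have hsplit : ∀ e, ∑ i : Fin m, T ^ (i : ℕ) * (z i.castSucc + correction L T lam e i)
      = ∑ i : Fin m, T ^ (i : ℕ) * z i.castSucc + (stepFun L T lam e - e) := by
    intro e
    simp only [mul_add, Finset.sum_add_distrib, stepFun]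
    ring
  -- Here `e` is not yet tied to `u - z' 0`: with `e` from the scalar equation this gives existence,
  -- with `e = u - y 0` uniqueness.
  have scalar : ∀ z' : Fin (m + 1) → ℝ, ∀ e ξ : ℝ,
      (∀ i : Fin m, z' i.castSucc = (z i.castSucc + correction L T lam e i) + T * z' i.succ) →
      z' (Fin.last m) = z (Fin.last m) + T * lam (Fin.last m) * L * ξ →
      u - z' 0 - e = w - (stepFun L T lam e + b * ξ) := by
    intro z' e ξ h1 h2
    rw [backSubst_apply_zero h1, hsplit, h2, hb, hw]
    ring
  obtain ⟨e, ξ, hξ, he⟩ := exists_add_mul_setSign_eq continuousOn_stepFun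
    (fun e he => le_stepFun hL hT hlam he) (stepFun_neg (L := L) (T := T) (lam := lam)) hb0 w
  obtain ⟨v, hv, hvl⟩ := backSubst_exists T (fun i => z i.castSucc + correction L T lam e i)
    (z (Fin.last m) + T * lam (Fin.last m) * L * ξ)
  have hve : u - v 0 = e := by
    have := scalar v e ξ hv hvl
    rw [he] at this
    linarith
  refine ⟨v, mem_ired_F.2 ⟨?_, ξ, ?_, hvl⟩, fun y hy => ?_⟩
  · rw [hve]; exact hv
  · rwa [hve]
  · obtain ⟨hy1, ξ', hξ', hyl⟩ := mem_ired_F.1 hy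
    have hs := scalar y (u - y 0) ξ' hy1 hyl
    obtain ⟨h1, h2⟩ := eq_of_add_mul_setSign_eq (stepFun_strictMono hL hT hlam) hb0 hξ' hξ
      (by rw [he]; linarith)
    rw [h1] at hy1
    exact backSubst_unique hy1 hv (by rw [hyl, hvl, h2])

theorem ired_wellPosed (hL : 0 < L) (hT : 0 < T) (hlam : ∀ i, 0 < lam i) :
    (ired m L T lam a).WellPosed := by
  intro z₁ u
  choose s hs hsu using existsUnique_ired_step (a := a) hL hT hlam
  let y : ℕ → Fin (m + 1) → ℝ := fun k => Nat.rec z₁ (fun k r => s r (u (k + 1))) k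
  -- The recursion `y` starts at index `0`, the state sequence at index `1`.
  refine ⟨fun k => y (k - 1), ⟨rfl, fun k hk => ?_⟩, fun z' hz' k hk => ?_⟩
  · obtain ⟨k, rfl⟩ : ∃ l, k = l + 1 := ⟨k - 1, by omega⟩
    exact hs _ _
  · induction k, hk using Nat.le_induction with
    | base => exact hz'.1
    | succ k hk ih =>
      obtain ⟨k, rfl⟩ : ∃ l, k = l + 1 := ⟨k - 1, by omega⟩
      have h := hsu _ _ _ (hz'.2 (k + 1) hk)
      rw [ih] at h
      exact h

/-- Off zero the set-valued sign is a singleton, so the right-hand side contains only `z (k + 1)`.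
At zero, `ξ` may be replaced by another point of `[-1, 1]`, which changes the last coordinate
because its gain is nonzero. -/
theorem ired_inSlidingMode_iff (hL : 0 < L) (hT : 0 < T) (hlam : ∀ i, 0 < lam i)
    {u : ℕ → ℝ} {z : ℕ → Fin (m + 1) → ℝ} (hz : (ired m L T lam a).IsSolution u z) {k : ℕ}
    (hk : 1 ≤ k) : (ired m L T lam a).InSlidingMode u z k ↔ z (k + 1) 0 = u k := by
  obtain ⟨h1, ξ, hξ, h2⟩ := mem_ired_F.1 (hz.2 k hk)
  have hg : T * lam (Fin.last m) * L ≠ 0 := by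
    have := hlam (Fin.last m); positivity
  constructor
  · rintro ⟨w, hw, hne⟩
    by_contra hcon
    have he : u k - z (k + 1) 0 ≠ 0 := fun h => hcon (by linarith)
    obtain ⟨hw1, ξ', hξ', hw2⟩ := mem_ired_F.1 hw
    apply hne
    have hsgn : ∀ {x}, x ∈ setSign (u k - z (k + 1) 0) → x = Real.sign (u k - z (k + 1) 0) := by
      rintro x (⟨-, h⟩ | ⟨h, -⟩)
      · exact h
      · exact absurd h he
    refine funext fun i => ?_
    refine Fin.lastCases ?_ (fun i => ?_) i
    · rw [hw2, h2, hsgn hξ, hsgn hξ']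
    · rw [hw1, h1]
  · intro h
    have he : u k - z (k + 1) 0 = 0 := by linarith
    obtain ⟨ξ', hξ', hne⟩ : ∃ ξ' ∈ Set.Icc (-1 : ℝ) 1, ξ' ≠ ξ := by
      by_cases hc : ξ = 1
      · exact ⟨0, by norm_num, by rw [hc]; norm_num⟩
      · exact ⟨1, by norm_num, fun h => hc h.symm⟩
    refine ⟨Fin.lastCases (z k (Fin.last m) + T * lam (Fin.last m) * L * ξ')
      fun i => z (k + 1) i.castSucc, mem_ired_F.2 ⟨fun i => ?_, ξ', Or.inr ⟨he, hξ'⟩, ?_⟩, ?_⟩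
    · simpa using h1 i
    · simp
    · intro hw
      have := congrFun hw (Fin.last m)
      simp only [Fin.lastCases_last] at this
      rw [h2] at this
      exact hne (mul_left_cancel₀ hg (add_left_cancel this))

/-! ### The output in sliding mode and its error. -/

/-- Each further difference needs one more past sample within the sliding phase, hence the delay
`j`. -/
theorem ired_state_eq_fwdDiff (hT : 0 < T) {f : ℝ → ℝ} {u : ℕ → ℝ} {z : ℕ → Fin (m + 1) → ℝ}
    (hz : (ired m L T lam a).IsSolution u z) {K : ℕ} (hK : 1 ≤ K)
    (hu : ∀ k, K ≤ k → u k = f (k * T)) (hs : ∀ k, K ≤ k → z (k + 1) 0 = u k)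
    (j : Fin (m + 1)) {k : ℕ} (hk : K + j ≤ k) :
    z (k + 1) j = (fwdDiff (-T))^[j] f (k * T) / (-T) ^ (j : ℕ) := by
  induction j using Fin.induction generalizing k with
  | zero =>
    have hk' : K ≤ k := by simpa using hk
    simp [hs k hk', hu k hk']
  | succ i ih =>
    simp only [Fin.val_succ, Fin.val_castSucc] at hk ih ⊢
    have h := (mem_ired_F.1 (hz.2 k (by omega))).1 i
    rw [show u k - z (k + 1) 0 = 0 by rw [hs k (by omega), sub_self], correction_zero, add_zero,
      ih (by omega)] at h
    obtain ⟨k, rfl⟩ : ∃ l, k = l + 1 := ⟨k - 1, by omega⟩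
    rw [ih (by omega)] at h
    rw [Function.iterate_succ_apply', fwdDiff,
      show ((k + 1 : ℕ) : ℝ) * T + -T = k * T by push_cast; ring, pow_succ]
    have hT' : (-T) ^ (i : ℕ) ≠ 0 := pow_ne_zero _ (neg_ne_zero.2 hT.ne')
    have hne := hT.ne'
    generalize (-T) ^ (i : ℕ) = P at *
    field_simp at h ⊢
    linarith

theorem ired_output_eq (hT : 0 < T) {f : ℝ → ℝ} {u : ℕ → ℝ} {z : ℕ → Fin (m + 1) → ℝ}
    (hz : (ired m L T lam a).IsSolution u z) {K : ℕ} (hK : 1 ≤ K)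
    (hu : ∀ k, K ≤ k → u k = f (k * T)) (hs : ∀ k, K ≤ k → z (k + 1) 0 = u k)
    (i : Fin m) {k : ℕ} (hk : K + m ≤ k) :
    (ired m L T lam a).output u z k i
      = (Polynomial.derivative^[(i : ℕ) + 1] (newtonInterp f (k * T) (-T) m)).eval (k * T) := by
  have hp : T ^ ((i : ℕ) + 1) ≠ 0 := pow_ne_zero _ hT.ne'
  apply mul_left_cancel₀ hp
  have key := eval_iterate_derivative_newtonInterp f (k * T) (neg_ne_zero.2 hT.ne') m (i + 1)
  simp only [neg_neg] at key
  rw [key, Finset.sum_range]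
  change _ * ∑ j ∈ Finset.Ici i.succ,
    T ^ ((j : ℕ) - ((i : ℕ) + 1)) * c ((i : ℕ) + 1) (j : ℕ) * z (k + 1) j = _
  rw [Finset.mul_sum, ← Finset.sum_subset (Finset.subset_univ (Finset.Ici i.succ))]
  · refine Finset.sum_congr rfl fun j hj => ?_
    have hij : (i : ℕ) + 1 ≤ j := by simpa [Fin.le_def] using hj
    rw [ired_state_eq_fwdDiff hT hz hK hu hs j (by omega), ← mul_assoc, ← mul_assoc, ← pow_add,
      Nat.add_sub_cancel' hij]
  · intro j _ hj
    have hij : (j : ℕ) < i + 1 := by simpa [Fin.lt_def] using hj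
    rw [c_eq_zero_of_lt hij]
    simp

/-- In sliding mode, the differentiation error is a divided difference of `f^(m)`. -/
theorem ired_error (hT : 0 < T) {f : ℝ → ℝ} {u : ℕ → ℝ} {z : ℕ → Fin (m + 1) → ℝ}
    (hz : (ired m L T lam a).IsSolution u z) {K : ℕ} (hK : 1 ≤ K)
    (hu : ∀ k, K ≤ k → u k = f (k * T)) (hs : ∀ k, K ≤ k → z (k + 1) 0 = u k)
    (hf : ∀ j < m, DifferentiableOn ℝ (sderiv j f) (Set.Ici 0))
    (i : Fin m) {k : ℕ} (hk : K + m ≤ k) :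
    ∃ s t, 0 ≤ s ∧ s < t ∧
      (ired m L T lam a).output u z k i - sderiv (i + 1) f (k * T)
        = -(c (i + 1) (m + 1) * T ^ (m - (i : ℕ))
          * ((sderiv m f t - sderiv m f s) / (t - s))) := by
  rw [ired_output_eq hT hz hK hu hs i hk]
  refine newtonInterp_deriv_error hT ?_ hf i.2
  -- This keeps all interpolation nodes in `[0, ∞)`.
  have : (m : ℝ) ≤ k := by exact_mod_cast (by omega : m ≤ k)
  gcongr

theorem ired_error_le (hT : 0 < T) {M : ℝ} {f : ℝ → ℝ} {u : ℕ → ℝ}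
    {z : ℕ → Fin (m + 1) → ℝ}
    (hz : (ired m L T lam a).IsSolution u z) {K : ℕ} (hK : 1 ≤ K)
    (hu : ∀ k, K ≤ k → u k = f (k * T)) (hs : ∀ k, K ≤ k → z (k + 1) 0 = u k)
    (hf : f ∈ signalClass m M) (i : Fin m) {k : ℕ} (hk : K + m ≤ k) :
    |(ired m L T lam a).output u z k i - sderiv (i + 1) f (k * T)|
      ≤ c (i + 1) (m + 1) * M * T ^ (m - (i : ℕ)) := by
  obtain ⟨s, t, hs0, hst, h⟩ := ired_error hT hz hK hu hs hf.1 i hk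
  have hc := c_nonneg (i + 1) (m + 1)
  have hslope : |(sderiv m f t - sderiv m f s) / (t - s)| ≤ M := by
    rw [abs_div, abs_of_pos (sub_pos.2 hst), div_le_iff₀ (sub_pos.2 hst)]
    exact abs_sub_le_of_signalClass hf hs0 hst.le
  rw [h, abs_neg, abs_mul, abs_of_nonneg (mul_nonneg hc (pow_nonneg hT.le _)), mul_right_comm]
  gcongr

/-- The error for a polynomial signal of degree at most `m + 1`. -/
theorem ired_error_polynomial (hT : 0 < T) {f : ℝ → ℝ} {u : ℕ → ℝ}
    {z : ℕ → Fin (m + 1) → ℝ}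
    (hz : (ired m L T lam a).IsSolution u z) {K : ℕ} (hK : 1 ≤ K)
    (hu : ∀ k, K ≤ k → u k = f (k * T)) (hs : ∀ k, K ≤ k → z (k + 1) 0 = u k)
    {p : Polynomial ℝ} (hp : p.natDegree ≤ m + 1) (hf : ∀ t, 0 ≤ t → f t = p.eval t)
    (i : Fin m) {k : ℕ} (hk : K + m ≤ k) :
    (ired m L T lam a).output u z k i - sderiv (i + 1) f (k * T)
      = -(c (i + 1) (m + 1) * T ^ (m - (i : ℕ)) * ((m + 1).factorial * p.coeff (m + 1))) := by
  obtain ⟨s, t, hs0, hst, h⟩ := ired_error hT hz hK hu hs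
    (fun j _ => differentiableOn_sderiv_of_eq_polynomial hf j) i hk
  rw [h, sderiv_eq_of_eq_polynomial hf m hs0, sderiv_eq_of_eq_polynomial hf m (hs0.trans hst.le),
    eval_iterate_derivative_sub hp, mul_div_cancel_right₀ _ (sub_pos.2 hst).ne']

end

end IRED

end

/-! ### Assembly of the theorem. -/

theorem theorem1 (m : ℕ) (hm : 1 ≤ m) (L T : ℝ) (hL : 0 < L) (hT : 0 < T)
    (lam : Fin (m + 1) → ℝ) (hlam : ∀ i, 0 < lam i) (a : Fin (m + 1) → ℝ) :
    -- the sliding mode is characterized by `z_{1,k+1} = u_k`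
    (∀ (u : ℕ → ℝ) (z : ℕ → Fin (m + 1) → ℝ), (IRED.ired m L T lam a).IsSolution u z →
      ∀ k, 1 ≤ k → ((IRED.ired m L T lam a).InSlidingMode u z k ↔ z (k + 1) 0 = u k)) ∧
    -- error bound, equality case, and exactness for polynomials
    (∀ M ∈ Set.Icc 0 L, ∀ (f : ℝ → ℝ) (η u : ℕ → ℝ) (z : ℕ → Fin (m + 1) → ℝ) (K : ℕ),
      (∀ k, u k = f (k * T) + η k) →
      (IRED.ired m L T lam a).IsSolution u z →
      1 ≤ K →
      (∀ k, K ≤ k → η k = 0) →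
      (∀ k, K ≤ k → (IRED.ired m L T lam a).InSlidingMode u z k) →
      (f ∈ IRED.signalClass m M →
        ∀ (i : Fin m) (k : ℕ), K + m + 1 ≤ k →
          |(IRED.ired m L T lam a).output u z k i - IRED.sderiv (i + 1) f (k * T)|
            ≤ IRED.c (i + 1) (m + 1) * M * T ^ (m - (i : ℕ))) ∧
      ((∀ t, 0 ≤ t → f t = M * t ^ (m + 1) / (Nat.factorial (m + 1) : ℝ)) →
        ∀ (i : Fin m) (k : ℕ), K + m + 1 ≤ k →
          |(IRED.ired m L T lam a).output u z k i - IRED.sderiv (i + 1) f (k * T)|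
            = IRED.c (i + 1) (m + 1) * M * T ^ (m - (i : ℕ))) ∧
      (∀ p : Polynomial ℝ, p.natDegree ≤ m → (∀ t, 0 ≤ t → f t = p.eval t) →
        ∀ (i : Fin m) (k : ℕ), K + m + 1 ≤ k →
          (IRED.ired m L T lam a).output u z k i
            = (Polynomial.derivative^[i + 1] p).eval (k * T))) ∧
    -- the differentiator is (well-posed and) a proper implicit discretization
    (IRED.ired m L T lam a).IsProper L T := by
  refine ⟨fun u z hz k hk => IRED.ired_inSlidingMode_iff hL hT hlam hz hk, ?_,
    IRED.ired_wellPosed hL hT hlam, fun i => IRED.c (i + 1) (m + 1), ?_⟩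
  · intro M hM f η u z K hu hz hK hη hsm
    have hu' : ∀ k, K ≤ k → u k = f (k * T) := fun k hk => by rw [hu, hη k hk, add_zero]
    have hs : ∀ k, K ≤ k → z (k + 1) 0 = u k := fun k hk =>
      (IRED.ired_inSlidingMode_iff hL hT hlam hz (hK.trans hk)).1 (hsm k hk)
    -- The error lemmas already apply from `K + m` on, one sample earlier than needed here.
    refine ⟨fun hf i k hk => IRED.ired_error_le hT hz hK hu' hs hf i (by omega),
      fun hf i k hk => ?_, fun p hp hf i k hk => ?_⟩
    · have hfac : ((m + 1).factorial : ℝ) ≠ 0 := by exact_mod_cast Nat.factorial_ne_zero _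
      have h := IRED.ired_error_polynomial hT hz hK hu' hs
        (p := Polynomial.C (M / (m + 1).factorial) * Polynomial.X ^ (m + 1))
        (Polynomial.natDegree_C_mul_X_pow_le _ _)
        (fun t ht => by
          rw [hf t ht, Polynomial.eval_mul, Polynomial.eval_C, Polynomial.eval_pow,
            Polynomial.eval_X]
          ring) i (k := k) (by omega)
      rw [Polynomial.coeff_C_mul_X_pow, if_pos rfl, mul_div_cancel₀ _ hfac] at h
      rw [h, abs_neg, abs_of_nonneg, mul_right_comm]
      exact mul_nonneg (mul_nonneg (IRED.c_nonneg _ _) (pow_nonneg hT.le _)) hM.1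
    · have h := IRED.ired_error_polynomial hT hz hK hu' hs (hp.trans m.le_succ) hf i (k := k)
        (by omega)
      rw [Polynomial.coeff_eq_zero_of_natDegree_lt (Nat.lt_succ_of_le hp), mul_zero, mul_zero,
        neg_zero, sub_eq_zero] at h
      rw [h, IRED.sderiv_eq_of_eq_polynomial hf _ (by positivity)]
  · intro M _ K hK f hf z hz hsm
    refine ⟨K + m, by omega, fun k hk i => ?_⟩
    exact IRED.ired_error_le hT hz hK (fun _ _ => rfl)
      (fun k hk => (IRED.ired_inSlidingMode_iff hL hT hlam hz (hK.trans hk)).1 (hsm k hk)) hf i hk
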